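/- Let $q\in(0,1)$, $\alpha\in(0,\infty)$ and let $n\ge 1$ be an integer. Let $\mathcal S$ be the set of $s=(s_x)_{x\in\mathbb Z}$ with $s_x\in\mathbb Z$ and $|s_{x+1}-s_x|=1$ for all $x\in\mathbb Z$. Dynamic ASEP is the continuous time Markov process $s(t)$ on $\mathcal S$ in which, independently for each $x\in\mathbb Z$ and whenever the result lies in $\mathcal S$, $$s_x\mapsto s_x-2\ \text{ at rate }\ \frac{q(1+\alpha q^{-s_x})}{1+\alpha q^{-s_x+1}},\qquad s_x\mapsto s_x+2\ \text{ at rate }\ \frac{1+\alpha q^{-s_x}}{1+\alpha q^{-s_x-1}}.$$ Its generator on local functions (functions of finitely many of the heights $s_x$) is denoted $\mathcal L_{q,\alpha}$; the process is understood as a càdlàg adapted solution of the martingale problem for $\mathcal L_{q,\alpha}$ on bounded local functions. Let $\mathcal X^n=\{x\in\mathbb Z^n: x_1>\dots>x_n\}$ and let $L^n_{1,q}$ be the generator of $n$-particle ASEP on $\mathcal X^n$, in which each particle jumps one step to the left at rate $1$ and one step to the right at rate $q$, jumps to occupied sites being suppressed. For $x\in\mathcal X^n$ and $s\in\mathcal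 S$ let $$Z_{n;q,\alpha}(x;s)=\prod_{k=1}^{n}\Big(q^{-x_k}-\alpha^{-1}q^{2(k-1)}-q^{k-1}\big(q^{\frac{-s_{x_k}-x_k}{2}}-\alpha^{-1}q^{\frac{s_{x_k}-x_k}{2}}\big)\Big).$$ Then for all $x\in\mathcal X^n$ and $s\in\mathcal S$, $$\mathcal L_{q,\alpha}Z_{n;q,\alpha}(x;s)=L^n_{1,q}Z_{n;q,\alpha}(x;s),$$ where $\mathcal L_{q,\alpha}$ acts in the variable $s$ and $L^n_{1,q}$ acts in the variable $x$. Consequently, if $s(t)$ is dynamic ASEP started from a fixed $s(0)\in\mathcal S$ or, more generally, from a random $s(0)$ such that $Z_{n;q,\alpha}(y;s(0))$ is integrable for every $y\in\mathcal X^n$, then $Z_{n;q,\alpha}(x;s(t))$ is integrable for all $x\in\mathcal X^n$ and $t\ge0$, and $$\frac{\partial}{\partial t}\,\mathbb E\big[Z_{n;q,\alpha}(x;s(t))\big]=L^n_{1,q}\,\mathbb E\big[Z_{n;q,\alpha}(x;s(t))\big]\qquad\text{for all }x\in\mathcal X^n,\ t\ge 0,$$ where $L^n_{1,q}$ acts in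 the variable $x$, and the derivative at $t=0$ is one-sided. -/

import Mathlib

open MeasureTheory Filter Topology
open scoped NNReal

noncomputable section

namespace DynASEP

/-! ### Height functions and dynamic ASEP -/

/-- Integer height functions on `ℤ` with slopes `± 1`. As a subtype of `ℤ → ℤ` it carries the
product (of discrete) topology and the product sigma-algebra. -/
abbrev HeightFunction : Type :=
  {s : ℤ → ℤ // ∀ x : ℤ, |s (x + 1) - s x| = 1}

open Classical in
/-- The height function obtained from `s` by changing `s x` to `s x + d`; if the result is not a
height function (the jump leaves the state space), the jump is suppressed. -/
def HeightFunction.jump (s : HeightFunction) (x d : ℤ) : HeightFunction :=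
  if h : ∀ y : ℤ, |Function.update s.1 x (s.1 x + d) (y + 1)
      - Function.update s.1 x (s.1 x + d) y| = 1 then
    ⟨Function.update s.1 x (s.1 x + d), h⟩
  else s

/-- Rate of the jump `h ↦ h - 2` of the height at a site. -/
def downRate (q α : ℝ) (h : ℤ) : ℝ :=
  q * (1 + α * q ^ (-h)) / (1 + α * q ^ (-h + 1))

/-- Rate of the jump `h ↦ h + 2` of the height at a site. -/
def upRate (q α : ℝ) (h : ℤ) : ℝ :=
  (1 + α * q ^ (-h)) / (1 + α * q ^ (-h - 1))

/-- `f` is a local function: it depends on the heights at finitely many sites only. -/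
def IsLocal (f : HeightFunction → ℝ) : Prop :=
  ∃ A : Finset ℤ, ∀ s s' : HeightFunction, (∀ x ∈ A, s.1 x = s'.1 x) → f s = f s'

/-- The generator of dynamic ASEP, on local functions of the height function. For a local function
the sum has only finitely many nonzero terms. -/
def dynamicGenerator (q α : ℝ) (f : HeightFunction → ℝ) (s : HeightFunction) : ℝ :=
  ∑ᶠ x : ℤ, (downRate q α (s.1 x) * (f (s.jump x (-2)) - f s)
    + upRate q α (s.1 x) * (f (s.jump x 2) - f s))

/-- `s` is a dynamic ASEP with parameters `q`, `α` (with any initial law) on the filtered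
probability space `(Ω, 𝓕, P)`: an adapted process of height functions with càdlàg paths which
solves the martingale problem for the generator on bounded local functions. -/
structure IsDynamicASEP {Ω : Type*} [mΩ : MeasurableSpace Ω] (q α : ℝ)
    (𝓕 : Filtration ℝ≥0 mΩ) (P : Measure Ω) (s : ℝ≥0 → Ω → HeightFunction) : Prop where
  adapted : ∀ t : ℝ≥0, Measurable[𝓕 t] (s t)
  right_continuous : ∀ (ω : Ω) (t : ℝ≥0), ContinuousWithinAt (fun u => s u ω) (Set.Ici t) t
  left_limits : ∀ (ω : Ω) (t : ℝ≥0), ∃ l : HeightFunction,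
    Tendsto (fun u => s u ω) (𝓝[<] t) (𝓝 l)
  martingale : ∀ f : HeightFunction → ℝ, IsLocal f → (∃ C : ℝ, ∀ σ, |f σ| ≤ C) →
    Martingale (fun (t : ℝ≥0) (ω : Ω) =>
      f (s t ω) - ∫ u in (0 : ℝ)..(t : ℝ), dynamicGenerator q α f (s u.toNNReal ω)) 𝓕 P

/-! ### Standard ASEP with `n` particles -/

/-- Ordered configurations `x₁ > ⋯ > xₙ` of `n` particles on `ℤ`; the particle with label `k` in
`{1, …, n}` is indexed by `k - 1 : Fin n`. -/
abbrev Config (n : ℕ) : Type := {x : Fin n → ℤ // StrictAnti x}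

open Classical in
/-- The configuration obtained from `x` by moving the `i`-th particle by `d`; if the result is not
strictly ordered (for `d = ± 1`: if the target site is occupied), the jump is suppressed. -/
def Config.move {n : ℕ} (x : Config n) (i : Fin n) (d : ℤ) : Config n :=
  if h : StrictAnti (Function.update x.1 i (x.1 i + d)) then
    ⟨Function.update x.1 i (x.1 i + d), h⟩
  else x

/-- The generator of `n`-particle ASEP with left jump rate `l` and right jump rate `r`. -/
def asepGenerator (n : ℕ) (l r : ℝ) (f : Config n → ℝ) (x : Config n) : ℝ :=
  ∑ i : Fin n, (l * (f (x.move i (-1)) - f x) + r * (f (x.move i 1) - f x))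

/-! ### The duality function -/

/-- The duality function. The factor with label `k` in `{1, …, n}` is indexed by `k - 1 : Fin n`,
so the powers `q ^ (k - 1)` and `q ^ (2 (k - 1))` become `q ^ k` and `q ^ (2 k)`. -/
def dualityZ (n : ℕ) (q α : ℝ) (x : Config n) (s : HeightFunction) : ℝ :=
  ∏ k : Fin n, (q ^ (-(x.1 k)) - α⁻¹ * q ^ (2 * (k : ℕ))
    - q ^ (k : ℕ) * (q ^ ((-(s.1 (x.1 k) : ℝ) - (x.1 k : ℝ)) / 2)
      - α⁻¹ * q ^ (((s.1 (x.1 k) : ℝ) - (x.1 k : ℝ)) / 2)))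

end DynASEP

end

noncomputable section

namespace DynASEP

/-! ### Jump rates and jumps of height functions -/

/-! Algebra. Write `q = p ^ 2`, `u = p ^ (-h - y)`, `v = p ^ (h - y)`. Since `u * v = q ^ (-y)`,
each factor of the duality function splits as `(u + α⁻¹ q ^ k) * (v - q ^ k)`
(`dualityFactor_eq_mul`), and the jump rates depend only on `u / v`. Checking the possible slopes at
`y` gives one-particle duality (`dualityFactor_generator`). The particles sit at distinct sites, so
a height jump affects at most one factor, and the generator of dynamic ASEP produces the sum of free
particle generators, without exclusion. The excess over ASEP comes from suppressed jumps. These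
occur in pairs, a left jump and the right jump of the adjacent particle, and each pair cancels
because of the label-dependent powers of `q` (`dualityFactor_adjacent`).

Analysis. The martingale problem covers bounded local functions only, while the duality function
grows like the weight `r ^ (n |s₀|)` with `r = q ^ (-1/2)`. It is also bounded below by a multiple
of this weight when `|s₀|` is large, so integrability at time zero gives an exponential moment. The
truncated weight `V` satisfies `|L V| ≤ K V` with `K` independent of the truncation; Grönwall and
Fatou propagate the moment to all times. Dominated convergence then extends Dynkin's formula to the
duality function. Its integrand is, by duality, a finite combination of continuous expectations, so
the integral equation can be differentiated. -/

lemma downRate_nonneg {q α : ℝ} (hq : 0 < q) (hα : 0 < α) (h : ℤ) : 0 ≤ downRate q α h := by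
  unfold downRate; positivity

lemma upRate_nonneg {q α : ℝ} (hq : 0 < q) (hα : 0 < α) (h : ℤ) : 0 ≤ upRate q α h := by
  unfold upRate; positivity

lemma downRate_le_one {q α : ℝ} (hq : 0 < q) (hq1 : q < 1) (hα : 0 < α) (h : ℤ) :
    downRate q α h ≤ 1 := by
  unfold downRate
  rw [div_le_one (by positivity), zpow_add_one₀ hq.ne']
  nlinarith

lemma upRate_le_one {q α : ℝ} (hq : 0 < q) (hq1 : q < 1) (hα : 0 < α) (h : ℤ) :
    upRate q α h ≤ 1 := by
  unfold upRate
  rw [div_le_one (by positivity), zpow_sub_one₀ hq.ne']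
  have h1 : 1 ≤ q⁻¹ := (one_le_inv₀ hq).2 hq1.le
  have h2 : 0 < α * q ^ (-h) := by positivity
  nlinarith

lemma HeightFunction.abs_sub_pred (s : HeightFunction) (x : ℤ) : |s.1 x - s.1 (x - 1)| = 1 := by
  simpa using s.2 (x - 1)

lemma HeightFunction.jump_admissible_iff (s : HeightFunction) (x d : ℤ) :
    (∀ y : ℤ, |Function.update s.1 x (s.1 x + d) (y + 1)
      - Function.update s.1 x (s.1 x + d) y| = 1) ↔
      |s.1 (x + 1) - (s.1 x + d)| = 1 ∧ |s.1 x + d - s.1 (x - 1)| = 1 := by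
  constructor
  · intro h
    have h1 := h x
    have h2 := h (x - 1)
    rw [Function.update_self, Function.update_of_ne (by omega)] at h1
    rw [sub_add_cancel, Function.update_self, Function.update_of_ne (by omega)] at h2
    exact ⟨h1, h2⟩
  · rintro ⟨h1, h2⟩ y
    rcases eq_or_ne y x with rfl | hy
    · rwa [Function.update_self, Function.update_of_ne (by omega)]
    rcases eq_or_ne (y + 1) x with rfl | hy'
    · rw [Function.update_self, Function.update_of_ne hy]
      simpa using h2
    · rw [Function.update_of_ne hy, Function.update_of_ne hy']
      exact s.2 y

lemma HeightFunction.jump_apply_of_ne (s : HeightFunction) (x d : ℤ) {y : ℤ} (hy : y ≠ x) :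
    (s.jump x d).1 y = s.1 y := by
  unfold HeightFunction.jump
  split_ifs
  · simp [hy]
  · rfl

lemma HeightFunction.jump_apply_self (s : HeightFunction) (x d : ℤ) :
    (s.jump x d).1 x = if |s.1 (x + 1) - (s.1 x + d)| = 1 ∧ |s.1 x + d - s.1 (x - 1)| = 1
      then s.1 x + d else s.1 x := by
  unfold HeightFunction.jump
  split_ifs with h1 h2 h2
  · simp
  · exact absurd ((s.jump_admissible_iff x d).1 h1) h2
  · exact absurd ((s.jump_admissible_iff x d).2 h2) h1
  · rfl

lemma HeightFunction.abs_jump_le (s : HeightFunction) (x d y : ℤ) :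
    |(s.jump x d).1 y| ≤ |s.1 y| + |d| := by
  rcases eq_or_ne y x with rfl | hy
  · rw [s.jump_apply_self]
    split_ifs
    · exact abs_add_le _ _
    · exact le_add_of_nonneg_right (abs_nonneg d)
  · rw [s.jump_apply_of_ne x d hy]
    exact le_add_of_nonneg_right (abs_nonneg d)

/-- Slopes are `± 1`, so the height at the origin controls the height at any fixed site; one weight
at `0` therefore suffices for all growth bounds. -/
lemma HeightFunction.abs_sub_le (s : HeightFunction) (x : ℤ) : |s.1 x - s.1 0| ≤ |x| := by
  induction x using Int.induction_on with
  | zero => simp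
  | succ i ih =>
    have := s.2 i
    rw [abs_of_nonneg (by omega : (0 : ℤ) ≤ i + 1)]
    rw [abs_of_nonneg (by omega : (0 : ℤ) ≤ i)] at ih
    rw [abs_le] at ih ⊢
    rw [abs_eq one_pos.le] at this
    omega
  | pred i ih =>
    have := s.abs_sub_pred (-i)
    rw [abs_of_nonpos (by omega : (-i - 1 : ℤ) ≤ 0)]
    rw [abs_of_nonpos (by omega : (-i : ℤ) ≤ 0)] at ih
    rw [abs_le] at ih ⊢
    rw [abs_eq one_pos.le] at this
    omega

/-! ### The generator on local functions -/

/-- `f` depends only on the heights in `A`. -/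
def DependsOnSites (f : HeightFunction → ℝ) (A : Finset ℤ) : Prop :=
  ∀ s s' : HeightFunction, (∀ x ∈ A, s.1 x = s'.1 x) → f s = f s'

/-- The part of the generator of dynamic ASEP that changes the height at the site `x`. -/
def siteGenerator (q α : ℝ) (f : HeightFunction → ℝ) (x : ℤ) (s : HeightFunction) : ℝ :=
  downRate q α (s.1 x) * (f (s.jump x (-2)) - f s) + upRate q α (s.1 x) * (f (s.jump x 2) - f s)

lemma DependsOnSites.jump_eq {f : HeightFunction → ℝ} {A : Finset ℤ} (hf : DependsOnSites f A)
    (s : HeightFunction) {x : ℤ} (hx : x ∉ A) (d : ℤ) : f (s.jump x d) = f s :=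
  hf _ _ fun _ hy => s.jump_apply_of_ne x d fun h => hx (h ▸ hy)

lemma DependsOnSites.dynamicGenerator_eq {f : HeightFunction → ℝ} {A : Finset ℤ}
    (hf : DependsOnSites f A) (q α : ℝ) (s : HeightFunction) :
    dynamicGenerator q α f s = ∑ x ∈ A, siteGenerator q α f x s := by
  refine finsum_eq_sum_of_support_subset _ fun x hx => ?_
  by_contra hxA
  have hxA' : x ∉ A := by simpa using hxA
  simp [hf.jump_eq s hxA'] at hx

lemma abs_siteGenerator_le {q α : ℝ} (hq : 0 < q) (hq1 : q < 1) (hα : 0 < α)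
    (f : HeightFunction → ℝ) (x : ℤ) (s : HeightFunction) :
    |siteGenerator q α f x s| ≤ |f (s.jump x (-2)) - f s| + |f (s.jump x 2) - f s| := by
  refine (abs_add_le _ _).trans (add_le_add ?_ ?_)
  · rw [abs_mul, abs_of_nonneg (downRate_nonneg hq hα _)]
    exact mul_le_of_le_one_left (abs_nonneg _) (downRate_le_one hq hq1 hα _)
  · rw [abs_mul, abs_of_nonneg (upRate_nonneg hq hα _)]
    exact mul_le_of_le_one_left (abs_nonneg _) (upRate_le_one hq hq1 hα _)

lemma isLocal_dynamicGenerator {f : HeightFunction → ℝ} (hf : IsLocal f) (q α : ℝ) :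
    IsLocal (dynamicGenerator q α f) := by
  obtain ⟨A, hA⟩ := hf
  -- Whether a jump at `x` is admissible depends on the heights at `x ± 1`, so the neighbours of `A`
  -- have to be included.
  refine ⟨A ∪ A.image (· + 1) ∪ A.image (· - 1), fun s s' h => ?_⟩
  have h0 : ∀ x ∈ A, s.1 x = s'.1 x := fun x hx => h x (by simp [hx])
  have h1 : ∀ x ∈ A, s.1 (x + 1) = s'.1 (x + 1) := fun x hx => h _ (by simp [hx])
  have h2 : ∀ x ∈ A, s.1 (x - 1) = s'.1 (x - 1) := fun x hx =>
    h _ (Finset.mem_union_right _ (Finset.mem_image_of_mem _ hx))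
  rw [DependsOnSites.dynamicGenerator_eq hA, DependsOnSites.dynamicGenerator_eq hA]
  refine Finset.sum_congr rfl fun x hx => ?_
  have hj : ∀ d, f (s.jump x d) = f (s'.jump x d) := fun d => hA _ _ fun y hy => by
    rcases eq_or_ne y x with rfl | hyx
    · rw [s.jump_apply_self, s'.jump_apply_self, h0 y hy, h1 y hy, h2 y hy]
    · rw [s.jump_apply_of_ne x d hyx, s'.jump_apply_of_ne x d hyx, h0 y hy]
  rw [siteGenerator, siteGenerator, hj, hj, h0 x hx, hA s s' h0]

/-! ### The factors of the duality function -/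

/-- The factor of the duality function of a particle at `y`, when the height there is `h`. -/
def dualityFactor (q α : ℝ) (k : ℕ) (y h : ℤ) : ℝ :=
  q ^ (-y) - α⁻¹ * q ^ (2 * k) - q ^ k * (q ^ ((-(h : ℝ) - (y : ℝ)) / 2)
    - α⁻¹ * q ^ (((h : ℝ) - (y : ℝ)) / 2))

lemma rpow_sq_div_two {p : ℝ} (hp : 0 < p) (m : ℤ) : (p ^ 2) ^ ((m : ℝ) / 2) = p ^ m := by
  rw [← Real.rpow_natCast, ← Real.rpow_mul hp.le, ← Real.rpow_intCast]
  congr 1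
  push_cast
  ring

lemma dualityFactor_sq {p : ℝ} (hp : 0 < p) (α : ℝ) (k : ℕ) (y h : ℤ) :
    dualityFactor (p ^ 2) α k y h =
      p ^ (-(2 * y)) - α⁻¹ * p ^ (4 * k) - p ^ (2 * k) * (p ^ (-h - y) - α⁻¹ * p ^ (h - y)) := by
  have h1 := rpow_sq_div_two hp (-h - y)
  have h2 := rpow_sq_div_two hp (h - y)
  push_cast at h1 h2
  rw [dualityFactor, h1, h2, ← pow_mul, ← pow_mul, ← zpow_natCast p 2, ← zpow_mul]
  congr 3
  · push_cast; ring
  · ring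

/-- The term `q ^ (-y)` is the product of the two exponentials of the height, which makes the
four-term expression factor. -/
lemma dualityFactor_eq_mul {p : ℝ} (hp : 0 < p) (α : ℝ) (k : ℕ) (y h : ℤ) :
    dualityFactor (p ^ 2) α k y h =
      (p ^ (-h - y) + α⁻¹ * p ^ (2 * k)) * (p ^ (h - y) - p ^ (2 * k)) := by
  rw [dualityFactor_sq hp, show -(2 * y) = (-h - y) + (h - y) by ring, zpow_add₀ hp.ne']
  ring

/-- One-particle duality. -/
lemma dualityFactor_generator {q α : ℝ} (hq : 0 < q) (hα : 0 < α) (k : ℕ) (y : ℤ)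
    (s : HeightFunction) :
    downRate q α (s.1 y) *
        (dualityFactor q α k y ((s.jump y (-2)).1 y) - dualityFactor q α k y (s.1 y))
      + upRate q α (s.1 y) *
        (dualityFactor q α k y ((s.jump y 2).1 y) - dualityFactor q α k y (s.1 y))
      = (dualityFactor q α k (y - 1) (s.1 (y - 1)) - dualityFactor q α k y (s.1 y))
        + q * (dualityFactor q α k (y + 1) (s.1 (y + 1)) - dualityFactor q α k y (s.1 y)) := by
  obtain ⟨p, hp, rfl⟩ : ∃ p : ℝ, 0 < p ∧ q = p ^ 2 :=
    ⟨√q, Real.sqrt_pos.2 hq, (Real.sq_sqrt hq.le).symm⟩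
  rw [s.jump_apply_self, s.jump_apply_self]
  have h1 := s.2 y
  have h2 := s.abs_sub_pred y
  generalize s.1 (y + 1) = a at *
  generalize s.1 (y - 1) = b at *
  generalize s.1 y = h at *
  rw [abs_eq one_pos.le] at h1 h2
  have ha : a = h + 1 ∨ a = h - 1 := by omega
  have hb : b = h + 1 ∨ b = h - 1 := by omega
  have hu : 0 < p ^ (-h - y) := by positivity
  have hv : 0 < p ^ (h - y) := by positivity
  -- This turns both rates into rational functions of `u = p ^ (-h - y)` and `v = p ^ (h - y)`.
  have huv : (p ^ 2) ^ (-h) = p ^ (-h - y) / p ^ (h - y) := by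
    rw [← zpow_sub₀ hp.ne', ← zpow_natCast, ← zpow_mul]
    congr 1
    push_cast
    ring
  have hq' : (p ^ 2 : ℝ) ≠ 0 := by positivity
  have e1 : ∀ m : ℤ, -(h + m) - y = -h - y + -m := fun m => by ring
  have e2 : ∀ m : ℤ, h + m - y = h - y + m := fun m => by ring
  have m2 : p ^ (-2 : ℤ) = (p ^ 2)⁻¹ := by rw [zpow_neg]; norm_cast
  have p2 : p ^ (2 : ℤ) = p ^ 2 := by norm_cast
  simp only [dualityFactor_eq_mul hp, downRate, upRate, zpow_add_one₀ hq', zpow_sub_one₀ hq', huv]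
  -- In order: a local minimum (only the up jump is allowed), the two monotone slopes (no jump, and
  -- both sides vanish), a local maximum (only the down jump).
  rcases ha with rfl | rfl <;> rcases hb with rfl | rfl
  · rw [if_neg (by simp only [abs_eq one_pos.le]; omega),
      if_pos (by simp only [abs_eq one_pos.le]; omega), e1, e2,
      show -(h + 1) - (y - 1) = -h - y by ring, show h + 1 - (y - 1) = h - y + 2 by ring,
      show -(h + 1) - (y + 1) = -h - y + -2 by ring, show h + 1 - (y + 1) = h - y by ring]
    simp only [zpow_add₀ hp.ne', m2, p2]
    generalize p ^ (-h - y) = u at *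
    generalize p ^ (h - y) = v at *
    have : v * p ^ 2 + α * u ≠ 0 := by positivity
    field_simp
    ring
  · rw [if_neg (by simp only [abs_eq one_pos.le]; omega),
      if_neg (by simp only [abs_eq one_pos.le]; omega),
      show -(h - 1) - (y - 1) = -h - y + 2 by ring, show h - 1 - (y - 1) = h - y by ring,
      show -(h + 1) - (y + 1) = -h - y + -2 by ring, show h + 1 - (y + 1) = h - y by ring]
    simp only [zpow_add₀ hp.ne', m2, p2]
    field_simp
    ring
  · rw [if_neg (by simp only [abs_eq one_pos.le]; omega),
      if_neg (by simp only [abs_eq one_pos.le]; omega),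
      show -(h + 1) - (y - 1) = -h - y by ring, show h + 1 - (y - 1) = h - y + 2 by ring,
      show -(h - 1) - (y + 1) = -h - y by ring, show h - 1 - (y + 1) = h - y + -2 by ring]
    simp only [zpow_add₀ hp.ne', m2, p2]
    field_simp
    ring
  · rw [if_pos (by simp only [abs_eq one_pos.le]; omega),
      if_neg (by simp only [abs_eq one_pos.le]; omega), e1, e2,
      show -(h - 1) - (y - 1) = -h - y + 2 by ring, show h - 1 - (y - 1) = h - y by ring,
      show -(h - 1) - (y + 1) = -h - y by ring, show h - 1 - (y + 1) = h - y + -2 by ring]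
    simp only [zpow_add₀ hp.ne', m2, p2, neg_neg]
    generalize p ^ (-h - y) = u at *
    generalize p ^ (h - y) = v at *
    have : v + α * u * p ^ 2 ≠ 0 := by positivity
    field_simp
    ring

/-- The two suppressed jumps of a pair of neighbouring particles cancel. -/
lemma dualityFactor_adjacent {q : ℝ} (hq : 0 < q) (α : ℝ) (k : ℕ) (y : ℤ) (s : HeightFunction) :
    (dualityFactor q α k (y - 1) (s.1 (y - 1)) - dualityFactor q α k y (s.1 y))
        * dualityFactor q α (k + 1) (y - 1) (s.1 (y - 1))
      + q * (dualityFactor q α k y (s.1 y) * (dualityFactor q α (k + 1) y (s.1 y)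
        - dualityFactor q α (k + 1) (y - 1) (s.1 (y - 1)))) = 0 := by
  obtain ⟨p, hp, rfl⟩ : ∃ p : ℝ, 0 < p ∧ q = p ^ 2 :=
    ⟨√q, Real.sqrt_pos.2 hq, (Real.sq_sqrt hq.le).symm⟩
  have h2 := s.abs_sub_pred y
  generalize s.1 (y - 1) = b at *
  generalize s.1 y = h at *
  have hP : p ^ h ≠ 0 := by positivity
  have hY : p ^ y ≠ 0 := by positivity
  rw [abs_eq one_pos.le] at h2
  have hb : b = h + 1 ∨ b = h - 1 := by omega
  simp only [dualityFactor_eq_mul hp]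
  -- Between neighbouring sites one of `u`, `v` is unchanged and the other is multiplied by `p ^ 2`.
  rcases hb with rfl | rfl
  · rw [show -(h + 1) - (y - 1) = -h - y by ring, show h + 1 - (y - 1) = h - y + 2 by ring,
      zpow_add₀ hp.ne']
    generalize p ^ (-h - y) = u
    generalize p ^ (h - y) = v
    norm_cast
    ring
  · rw [show -(h - 1) - (y - 1) = -h - y + 2 by ring, show h - 1 - (y - 1) = h - y by ring,
      zpow_add₀ hp.ne']
    generalize p ^ (-h - y) = u
    generalize p ^ (h - y) = v
    norm_cast
    ring

end DynASEP

namespace DynASEP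

/-! ### The Markov duality -/

/-- The duality function as a function of arbitrary particle positions. -/
def positionZ {n : ℕ} (q α : ℝ) (x : Fin n → ℤ) (s : HeightFunction) : ℝ :=
  ∏ k : Fin n, dualityFactor q α k (x k) (s.1 (x k))

lemma dualityZ_eq {n : ℕ} (q α : ℝ) (x : Config n) (s : HeightFunction) :
    dualityZ n q α x s = positionZ q α x.1 s := rfl

lemma positionZ_update {n : ℕ} (q α : ℝ) (x : Fin n → ℤ) (s : HeightFunction) (i : Fin n)
    (y : ℤ) : positionZ q α (Function.update x i y) s = dualityFactor q α i y (s.1 y) *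
      ∏ k ∈ Finset.univ \ {i}, dualityFactor q α k (x k) (s.1 (x k)) := by
  rw [← Finset.prod_update_of_mem (Finset.mem_univ i), positionZ]
  refine Finset.prod_congr rfl fun k _ => ?_
  rcases eq_or_ne k i with rfl | hk
  · simp
  · simp [hk]

lemma positionZ_eq_mul {n : ℕ} (q α : ℝ) (x : Fin n → ℤ) (s : HeightFunction) (i : Fin n) :
    positionZ q α x s = dualityFactor q α i (x i) (s.1 (x i)) *
      ∏ k ∈ Finset.univ \ {i}, dualityFactor q α k (x k) (s.1 (x k)) := by
  simpa using positionZ_update q α x s i (x i)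

/-- Injectivity ensures that no other factor sees the height at `x i`. -/
lemma positionZ_jump {n : ℕ} (q α : ℝ) {x : Fin n → ℤ} (hx : Function.Injective x)
    (s : HeightFunction) (i : Fin n) (d : ℤ) : positionZ q α x (s.jump (x i) d) =
      dualityFactor q α i (x i) ((s.jump (x i) d).1 (x i)) *
        ∏ k ∈ Finset.univ \ {i}, dualityFactor q α k (x k) (s.1 (x k)) := by
  rw [positionZ_eq_mul q α x _ i]
  congr 1
  refine Finset.prod_congr rfl fun k hk => ?_
  rw [s.jump_apply_of_ne]
  intro h
  simp [hx h] at hk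

lemma dependsOnSites_positionZ {n : ℕ} (q α : ℝ) (x : Fin n → ℤ) :
    DependsOnSites (positionZ q α x) (Finset.univ.image x) := fun s s' h =>
  Finset.prod_congr rfl fun k _ => by rw [h (x k) (by simp)]

lemma isLocal_dualityZ {n : ℕ} (q α : ℝ) (x : Config n) : IsLocal (dualityZ n q α x) :=
  ⟨_, dependsOnSites_positionZ q α x.1⟩

/-- The contribution of the `i`-th particle, jumping freely, to the particle generator. -/
def freeParticleGenerator {n : ℕ} (q α : ℝ) (x : Fin n → ℤ) (s : HeightFunction) (i : Fin n) : ℝ :=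
  (positionZ q α (Function.update x i (x i - 1)) s - positionZ q α x s)
    + q * (positionZ q α (Function.update x i (x i + 1)) s - positionZ q α x s)

lemma siteGenerator_positionZ {n : ℕ} {q α : ℝ} (hq : 0 < q) (hα : 0 < α) {x : Fin n → ℤ}
    (hx : Function.Injective x) (s : HeightFunction) (i : Fin n) :
    siteGenerator q α (positionZ q α x) (x i) s = freeParticleGenerator q α x s i := by
  rw [siteGenerator, freeParticleGenerator, positionZ_jump q α hx, positionZ_jump q α hx,
    positionZ_update, positionZ_update, positionZ_eq_mul q α x s i]
  linear_combination (∏ k ∈ Finset.univ \ {i}, dualityFactor q α k (x k) (s.1 (x k))) *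
    dualityFactor_generator hq hα i (x i) s

/-- Exclusion is invisible at this stage: one-particle duality is applied to each factor separately,
and the free jumps may place two particles on one site. -/
lemma dynamicGenerator_positionZ {n : ℕ} {q α : ℝ} (hq : 0 < q) (hα : 0 < α) {x : Fin n → ℤ}
    (hx : Function.Injective x) (s : HeightFunction) :
    dynamicGenerator q α (positionZ q α x) s = ∑ i, freeParticleGenerator q α x s i := by
  rw [(dependsOnSites_positionZ q α x).dynamicGenerator_eq, Finset.sum_image hx.injOn]
  exact Finset.sum_congr rfl fun i _ => siteGenerator_positionZ hq hα hx s i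

lemma strictAnti_update_pred_last {m : ℕ} {x : Fin (m + 1) → ℤ} (hx : StrictAnti x) :
    StrictAnti (Function.update x (Fin.last m) (x (Fin.last m) - 1)) := by
  intro a b hab
  have ha : a ≠ Fin.last m := (hab.trans_le (Fin.le_last b)).ne
  have := hx hab
  rw [Function.update_of_ne ha]
  rcases eq_or_ne b (Fin.last m) with rfl | hb
  · rw [Function.update_self]; omega
  · rwa [Function.update_of_ne hb]

lemma strictAnti_update_succ_zero {m : ℕ} {x : Fin (m + 1) → ℤ} (hx : StrictAnti x) :
    StrictAnti (Function.update x 0 (x 0 + 1)) := by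
  intro a b hab
  have hb : b ≠ 0 := ((Fin.zero_le a).trans_lt hab).ne'
  have := hx hab
  rw [Function.update_of_ne hb]
  rcases eq_or_ne a 0 with rfl | ha
  · rw [Function.update_self]; omega
  · rwa [Function.update_of_ne ha]

/-- The criterion is the same as for the right jump of the next particle in
`strictAnti_update_succ_succ`, so suppressed jumps come in pairs. -/
lemma strictAnti_update_pred_castSucc {m : ℕ} {x : Fin (m + 1) → ℤ} (hx : StrictAnti x)
    (j : Fin m) : StrictAnti (Function.update x j.castSucc (x j.castSucc - 1)) ↔
      x j.castSucc ≠ x j.succ + 1 := by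
  constructor
  · intro h he
    have := h j.castSucc_lt_succ
    rw [Function.update_self, Function.update_of_ne j.castSucc_lt_succ.ne'] at this
    omega
  · intro h a b hab
    have h1 := hx hab
    have h2 := hx j.castSucc_lt_succ
    rcases eq_or_ne a j.castSucc with rfl | ha
    · rw [Function.update_self, Function.update_of_ne hab.ne']
      have := hx.antitone (Fin.castSucc_lt_iff_succ_le.1 hab)
      omega
    · rw [Function.update_of_ne ha]
      rcases eq_or_ne b j.castSucc with rfl | hb
      · rw [Function.update_self]; omega
      · rwa [Function.update_of_ne hb]

lemma strictAnti_update_succ_succ {m : ℕ} {x : Fin (m + 1) → ℤ} (hx : StrictAnti x)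
    (j : Fin m) : StrictAnti (Function.update x j.succ (x j.succ + 1)) ↔
      x j.castSucc ≠ x j.succ + 1 := by
  constructor
  · intro h he
    have := h j.castSucc_lt_succ
    rw [Function.update_self, Function.update_of_ne j.castSucc_lt_succ.ne] at this
    omega
  · intro h a b hab
    have h1 := hx hab
    have h2 := hx j.castSucc_lt_succ
    rcases eq_or_ne b j.succ with rfl | hb
    · rw [Function.update_self, Function.update_of_ne hab.ne]
      have := hx.antitone (Fin.le_castSucc_iff.2 hab)
      omega
    · rw [Function.update_of_ne hb]
      rcases eq_or_ne a j.succ with rfl | ha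
      · rw [Function.update_self]; omega
      · rwa [Function.update_of_ne ha]

open Classical in
lemma dualityZ_move {n : ℕ} (q α : ℝ) (x : Config n) (s : HeightFunction) (i : Fin n) (d : ℤ) :
    dualityZ n q α (x.move i d) s = positionZ q α (Function.update x.1 i (x.1 i + d)) s
      - if StrictAnti (Function.update x.1 i (x.1 i + d)) then 0 else
        positionZ q α (Function.update x.1 i (x.1 i + d)) s - positionZ q α x.1 s := by
  unfold Config.move
  split_ifs <;> simp [dualityZ_eq]

/-- The contributions of the two suppressed jumps of neighbouring particles cancel. -/
lemma positionZ_adjacent {m : ℕ} {q : ℝ} (hq : 0 < q) (α : ℝ) (x : Fin (m + 1) → ℤ)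
    (s : HeightFunction) (j : Fin m) (hj : x j.castSucc = x j.succ + 1) :
    (positionZ q α (Function.update x j.castSucc (x j.castSucc - 1)) s - positionZ q α x s)
      + q * (positionZ q α (Function.update x j.succ (x j.succ + 1)) s - positionZ q α x s)
      = 0 := by
  have hne : j.castSucc ≠ j.succ := j.castSucc_lt_succ.ne
  have h1 := positionZ_update q α x s j.castSucc
  have h2 := positionZ_update q α x s j.succ
  have h0 := positionZ_eq_mul q α x s j.castSucc
  set F : Fin (m + 1) → ℝ := fun k => dualityFactor q α k (x k) (s.1 (x k)) with hF
  have e1 : ∏ k ∈ Finset.univ \ {j.castSucc}, F k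
      = F j.succ * ∏ k ∈ (Finset.univ \ {j.castSucc}) \ {j.succ}, F k := by
    rw [Finset.sdiff_singleton_eq_erase j.succ, Finset.mul_prod_erase]
    simpa using hne.symm
  have e2 : ∏ k ∈ Finset.univ \ {j.succ}, F k
      = F j.castSucc * ∏ k ∈ (Finset.univ \ {j.castSucc}) \ {j.succ}, F k := by
    rw [sdiff_right_comm, Finset.sdiff_singleton_eq_erase j.castSucc, Finset.mul_prod_erase]
    simpa using hne
  have hadj := dualityFactor_adjacent hq α j (x j.castSucc) s
  rw [h1, h2, h0, e1, e2]
  have hy : x j.succ = x j.castSucc - 1 := by omega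
  simp only [hF, hy, Fin.val_castSucc, Fin.val_succ, sub_add_cancel]
  linear_combination (∏ k ∈ (Finset.univ \ {j.castSucc}) \ {j.succ}, F k) * hadj

theorem dynamicGenerator_dualityZ {n : ℕ} {q α : ℝ} (hq : 0 < q) (hα : 0 < α) (x : Config n)
    (s : HeightFunction) : dynamicGenerator q α (dualityZ n q α x) s
      = asepGenerator n 1 q (fun x' => dualityZ n q α x' s) x := by
  classical
  have hL : dynamicGenerator q α (dualityZ n q α x) s = ∑ i, freeParticleGenerator q α x.1 s i :=
    dynamicGenerator_positionZ hq hα x.2.injective s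
  rw [hL]
  rcases n with _ | m
  · simp [asepGenerator]
  -- `A` and `B` collect the increments of the suppressed left and right jumps, which the free
  -- generator counts and ASEP does not.
  let A : Fin (m + 1) → ℝ := fun i => if StrictAnti (Function.update x.1 i (x.1 i - 1)) then 0 else
    positionZ q α (Function.update x.1 i (x.1 i - 1)) s - positionZ q α x.1 s
  let B : Fin (m + 1) → ℝ := fun i => if StrictAnti (Function.update x.1 i (x.1 i + 1)) then 0 else
    positionZ q α (Function.update x.1 i (x.1 i + 1)) s - positionZ q α x.1 s
  have hR : asepGenerator (m + 1) 1 q (fun x' => dualityZ (m + 1) q α x' s) x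
      = ∑ i, freeParticleGenerator q α x.1 s i - (∑ i, A i + ∑ i, q * B i) := by
    rw [← Finset.sum_add_distrib, ← Finset.sum_sub_distrib]
    refine Finset.sum_congr rfl fun i _ => ?_
    have h1 := dualityZ_move q α x s i (-1)
    rw [← sub_eq_add_neg] at h1
    beta_reduce
    rw [h1, dualityZ_move q α x s i 1, dualityZ_eq, freeParticleGenerator]
    ring
  -- Splitting off the last term of `A` and the first of `B`, neither of which is ever blocked,
  -- aligns the two jumps of each neighbouring pair at a common index `j`.
  rw [hR, eq_comm, sub_eq_self, Fin.sum_univ_castSucc, Fin.sum_univ_succ (fun i => q * B i)]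
  have hA : A (Fin.last m) = 0 := if_pos (strictAnti_update_pred_last x.2)
  have hB : B 0 = 0 := if_pos (strictAnti_update_succ_zero x.2)
  rw [hA, hB, add_zero, mul_zero, zero_add, ← Finset.sum_add_distrib]
  refine Finset.sum_eq_zero fun j _ => ?_
  simp only [A, B, strictAnti_update_pred_castSucc x.2, strictAnti_update_succ_succ x.2]
  split_ifs with h
  · simp
  · exact positionZ_adjacent hq α x.1 s j (not_not.1 h)

end DynASEP

namespace DynASEP

/-! ### Growth of the duality function in the heights -/

/-- The exponential weight `r ^ (n |s₀|)` of the height at the origin. -/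
def heightWeight (r : ℝ) (n : ℕ) (s : HeightFunction) : ℝ := (r ^ (s.1 0).natAbs) ^ n

lemma one_le_heightWeight {r : ℝ} (hr : 1 ≤ r) (n : ℕ) (s : HeightFunction) :
    1 ≤ heightWeight r n s := one_le_pow₀ (one_le_pow₀ hr)

lemma dependsOnSites_heightWeight (r : ℝ) (n : ℕ) : DependsOnSites (heightWeight r n) {0} :=
  fun s s' h => by rw [heightWeight, heightWeight, h 0 (by simp)]

lemma heightWeight_jump_le {r : ℝ} (hr : 1 ≤ r) (n : ℕ) (s : HeightFunction) (x : ℤ) {d : ℤ}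
    (hd : |d| = 2) : heightWeight r n (s.jump x d) ≤ (r ^ 2) ^ n * heightWeight r n s := by
  have hr0 : 0 ≤ r := zero_le_one.trans hr
  rw [heightWeight, heightWeight, ← mul_pow, ← pow_add]
  refine pow_le_pow_left₀ (pow_nonneg hr0 _) (pow_le_pow_right₀ hr ?_) n
  have := s.abs_jump_le x d 0
  simp only [Int.abs_eq_natAbs] at *
  omega

lemma dualityFactor_inv_sq {r : ℝ} (hr : 0 < r) (α : ℝ) (k : ℕ) (y h : ℤ) :
    dualityFactor ((r ^ 2)⁻¹) α k y h =
      (r ^ (2 * y) - α⁻¹ * r⁻¹ ^ (4 * k))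
        - r⁻¹ ^ (2 * k) * (r ^ (y + h) - α⁻¹ * r ^ (y - h)) := by
  rw [← inv_pow, dualityFactor_sq (inv_pos.2 hr)]
  simp only [inv_zpow', neg_neg, neg_sub]
  congr 4
  ring

lemma zpow_le_weight_mul {r : ℝ} (hr : 1 ≤ r) (s : HeightFunction) {y m : ℤ}
    (hm : m ≤ |s.1 y| + |y|) : r ^ m ≤ r ^ (s.1 0).natAbs * r ^ (2 * |y|) := by
  have hr0 : 0 < r := zero_lt_one.trans_le hr
  rw [← zpow_natCast, ← zpow_add₀ hr0.ne']
  refine zpow_le_zpow_right₀ hr ?_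
  have := s.abs_sub_le y
  simp only [Int.abs_eq_natAbs] at *
  omega

lemma exists_abs_dualityFactor_le {r : ℝ} (hr : 1 ≤ r) {α : ℝ} (hα : 0 < α) (k : ℕ) (y : ℤ) :
    ∃ C : ℝ, ∀ s : HeightFunction,
      |dualityFactor ((r ^ 2)⁻¹) α k y (s.1 y)| ≤ C * r ^ (s.1 0).natAbs := by
  have hr0 : 0 < r := zero_lt_one.trans_le hr
  refine ⟨|r ^ (2 * y) - α⁻¹ * r⁻¹ ^ (4 * k)|
    + r⁻¹ ^ (2 * k) * (r ^ (2 * |y|) + α⁻¹ * r ^ (2 * |y|)), fun s => ?_⟩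
  rw [dualityFactor_inv_sq hr0]
  have hR : 1 ≤ r ^ (s.1 0).natAbs := one_le_pow₀ hr
  have h1 : r ^ (y + s.1 y) ≤ r ^ (s.1 0).natAbs * r ^ (2 * |y|) :=
    zpow_le_weight_mul hr s (by linarith [le_abs_self y, le_abs_self (s.1 y)])
  have h2 : r ^ (y - s.1 y) ≤ r ^ (s.1 0).natAbs * r ^ (2 * |y|) :=
    zpow_le_weight_mul hr s (by linarith [le_abs_self y, neg_abs_le (s.1 y)])
  have hα' : 0 < α⁻¹ := inv_pos.2 hα
  have hp : 0 < r⁻¹ ^ (2 * k) := by positivity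
  have h3 : |r ^ (y + s.1 y) - α⁻¹ * r ^ (y - s.1 y)| ≤
      r ^ (y + s.1 y) + α⁻¹ * r ^ (y - s.1 y) := by
    refine (abs_sub _ _).trans_eq ?_
    rw [abs_of_pos (by positivity), abs_of_pos (by positivity)]
  refine (abs_sub _ _).trans ?_
  rw [abs_mul, abs_of_pos hp]
  calc _ ≤ |r ^ (2 * y) - α⁻¹ * r⁻¹ ^ (4 * k)| * r ^ (s.1 0).natAbs + r⁻¹ ^ (2 * k) *
        (r ^ (s.1 0).natAbs * r ^ (2 * |y|) + α⁻¹ * (r ^ (s.1 0).natAbs * r ^ (2 * |y|))) := by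
        refine add_le_add (le_mul_of_one_le_right (abs_nonneg _) hR) ?_
        refine mul_le_mul_of_nonneg_left (h3.trans ?_) hp.le
        gcongr
    _ = _ := by ring

/-- For a height of large modulus one of the two exponentials dominates and the other is bounded in
terms of `y`, so their opposite signs cannot cause cancellation. -/
lemma exists_le_abs_dualityFactor {r : ℝ} (hr : 1 ≤ r) {α : ℝ} (hα : 0 < α) (k : ℕ) (y : ℤ) :
    ∃ c > 0, ∃ R : ℝ, ∀ s : HeightFunction, R ≤ r ^ (s.1 0).natAbs →
      c * r ^ (s.1 0).natAbs ≤ |dualityFactor ((r ^ 2)⁻¹) α k y (s.1 y)| := by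
  have hr0 : 0 < r := zero_lt_one.trans_le hr
  have hα' : 0 < α⁻¹ := inv_pos.2 hα
  set K : ℝ := r ^ (2 * |y|) with hK
  set D : ℝ := |r ^ (2 * y) - α⁻¹ * r⁻¹ ^ (4 * k)| with hD
  set P : ℝ := r⁻¹ ^ (2 * k) with hP
  have hK0 : 0 < K := by positivity
  have hP0 : 0 < P := by positivity
  have hD0 : 0 ≤ D := abs_nonneg _
  set c : ℝ := min 1 α⁻¹ / K with hc
  have hc0 : 0 < c := div_pos (lt_min one_pos hα') hK0
  have key : ∀ s : HeightFunction, c * r ^ (s.1 0).natAbs - (1 + α⁻¹) * K ≤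
      |r ^ (y + s.1 y) - α⁻¹ * r ^ (y - s.1 y)| := by
    intro s
    have hs := s.abs_sub_le y
    have large : ∀ m : ℤ, |s.1 0| - 2 * |y| ≤ m → r ^ (s.1 0).natAbs ≤ K * r ^ m := by
      intro m hm
      rw [hK, ← zpow_natCast, ← zpow_add₀ hr0.ne']
      refine zpow_le_zpow_right₀ hr ?_
      simp only [Int.abs_eq_natAbs] at *
      omega
    have small : ∀ m : ℤ, m ≤ |y| → r ^ m ≤ K := fun m hm =>
      zpow_le_zpow_right₀ hr (by linarith [abs_nonneg y])
    have hX : 0 ≤ r ^ (s.1 0).natAbs := by positivity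
    rcases le_total 0 (s.1 y) with h | h
    · have h1 := large (y + s.1 y) (by simp only [Int.abs_eq_natAbs] at *; omega)
      have h2 := small (y - s.1 y) (by simp only [Int.abs_eq_natAbs] at *; omega)
      have h3 : c * r ^ (s.1 0).natAbs ≤ r ^ (y + s.1 y) := by
        rw [hc, div_mul_eq_mul_div, div_le_iff₀ hK0, mul_comm (r ^ (y + s.1 y))]
        exact (mul_le_of_le_one_left hX (min_le_left _ _)).trans h1
      refine le_trans ?_ (le_abs_self _)
      nlinarith
    · have h1 := large (y - s.1 y) (by simp only [Int.abs_eq_natAbs] at *; omega)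
      have h2 := small (y + s.1 y) (by simp only [Int.abs_eq_natAbs] at *; omega)
      have h3 : c * r ^ (s.1 0).natAbs ≤ α⁻¹ * r ^ (y - s.1 y) := by
        rw [hc, div_mul_eq_mul_div, div_le_iff₀ hK0, mul_assoc, mul_comm (r ^ (y - s.1 y))]
        exact mul_le_mul (min_le_right _ _) h1 hX hα'.le
      refine le_trans ?_ (neg_le_abs _)
      nlinarith
  -- Beyond this threshold the bounded terms absorb at most half of the main term `P * c * r ^
  -- |s₀|`.
  refine ⟨P * c / 2, by positivity, 2 * (P * ((1 + α⁻¹) * K) + D) / (P * c), fun s hsR => ?_⟩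
  rw [div_le_iff₀ (by positivity)] at hsR
  rw [dualityFactor_inv_sq hr0, abs_sub_comm]
  refine le_trans ?_ (abs_sub_abs_le_abs_sub _ _)
  rw [abs_mul, abs_of_pos hP0]
  have := mul_le_mul_of_nonneg_left (key s) hP0.le
  rw [← hD]
  nlinarith

lemma exists_abs_dualityZ_le {r : ℝ} (hr : 1 ≤ r) {α : ℝ} (hα : 0 < α) {n : ℕ} (x : Config n) :
    ∃ C : ℝ, ∀ s : HeightFunction,
      |dualityZ n ((r ^ 2)⁻¹) α x s| ≤ C * heightWeight r n s := by
  choose C hC using fun k : Fin n => exists_abs_dualityFactor_le hr hα k (x.1 k)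
  refine ⟨∏ k, C k, fun s => ?_⟩
  rw [dualityZ_eq, positionZ, Finset.abs_prod]
  refine (Finset.prod_le_prod (fun k _ => abs_nonneg _) fun k _ => hC k s).trans_eq ?_
  rw [Finset.prod_mul_distrib, Finset.prod_const, Finset.card_fin, heightWeight]

lemma exists_heightWeight_le {r : ℝ} (hr : 1 ≤ r) {α : ℝ} (hα : 0 < α) {n : ℕ} (x : Config n) :
    ∃ C C' : ℝ, ∀ s : HeightFunction,
      heightWeight r n s ≤ C * |dualityZ n ((r ^ 2)⁻¹) α x s| + C' := by
  choose c hc R hR using fun k : Fin n => exists_le_abs_dualityFactor hr hα k (x.1 k)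
  -- `M` exceeds the thresholds of all factors; where `r ^ |s₀| ≤ M` the weight is at most `|M| ^
  -- n`.
  obtain ⟨M, hM⟩ := Finset.exists_le (Finset.univ.image R)
  have hc0 : 0 < ∏ k, c k := Finset.prod_pos fun k _ => hc k
  refine ⟨(∏ k, c k)⁻¹, |M| ^ n, fun s => ?_⟩
  have hX : 0 ≤ r ^ (s.1 0).natAbs := pow_nonneg (zero_le_one.trans hr) _
  rcases le_total M (r ^ (s.1 0).natAbs) with h | h
  · refine le_add_of_le_of_nonneg ?_ (by positivity)
    rw [inv_mul_eq_div, le_div_iff₀ hc0, dualityZ_eq, positionZ, Finset.abs_prod]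
    have : heightWeight r n s * ∏ k, c k = ∏ k : Fin n, c k * r ^ (s.1 0).natAbs := by
      rw [Finset.prod_mul_distrib, Finset.prod_const, Finset.card_fin, heightWeight, mul_comm]
    rw [this]
    exact Finset.prod_le_prod (fun k _ => mul_nonneg (hc k).le hX) fun k _ =>
      hR k s ((hM _ (by simp)).trans h)
  · refine le_add_of_nonneg_of_le (by positivity) ?_
    exact pow_le_pow_left₀ hX (h.trans (le_abs_self M)) n

end DynASEP

namespace DynASEP

/-! ### Truncation -/

/-- Truncation of a real number to `[-M, M]`. -/
def clip (M z : ℝ) : ℝ := max (min z M) (-M)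

lemma abs_clip_le {M : ℝ} (hM : 0 ≤ M) (z : ℝ) : |clip M z| ≤ M :=
  abs_le.2 ⟨le_max_right _ _, max_le (min_le_right _ _) (by linarith)⟩

lemma abs_clip_sub_clip_le (M a b : ℝ) : |clip M a - clip M b| ≤ |a - b| :=
  (abs_sup_sub_sup_le_abs _ _ _).trans (abs_inf_sub_inf_le_abs _ _ _)

lemma clip_of_abs_le {M z : ℝ} (h : |z| ≤ M) : clip M z = z := by
  rw [clip, min_eq_left (abs_le.1 h).2, max_eq_left (abs_le.1 h).1]

lemma abs_clip_le_abs {M : ℝ} (hM : 0 ≤ M) (z : ℝ) : |clip M z| ≤ |z| := by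
  simpa [clip_of_abs_le (M := M) (z := 0) (by simpa)] using abs_clip_sub_clip_le M z 0

lemma tendsto_clip (z : ℝ) : Tendsto (fun N : ℕ => clip N z) atTop (𝓝 z) :=
  tendsto_const_nhds.congr' <| by
    filter_upwards [eventually_ge_atTop ⌈|z|⌉₊] with N hN
    rw [clip_of_abs_le ((Nat.le_ceil _).trans (by exact_mod_cast hN))]

lemma IsLocal.clip {f : HeightFunction → ℝ} (hf : IsLocal f) (M : ℝ) :
    IsLocal fun s => clip M (f s) := by
  obtain ⟨A, hA⟩ := hf
  exact ⟨A, fun s s' h => by simp only [hA s s' h]⟩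

lemma tendsto_dynamicGenerator_clip {f : HeightFunction → ℝ} (hf : IsLocal f) (q α : ℝ)
    (s : HeightFunction) :
    Tendsto (fun N : ℕ => dynamicGenerator q α (fun s' => clip N (f s')) s) atTop
      (𝓝 (dynamicGenerator q α f s)) := by
  obtain ⟨A, hA⟩ := hf
  have hA' : ∀ N : ℕ, DependsOnSites (fun s' => DynASEP.clip N (f s')) A :=
    fun N s s' h => by simp only [hA s s' h]
  rw [DependsOnSites.dynamicGenerator_eq hA]
  simp_rw [fun N : ℕ => (hA' N).dynamicGenerator_eq q α s]
  refine tendsto_finsetSum _ fun x _ => ?_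
  exact ((tendsto_clip _).sub (tendsto_clip _)).const_mul _ |>.add
    (((tendsto_clip _).sub (tendsto_clip _)).const_mul _)

/-! ### Continuity and measurability -/

/-- A local function factors through a finite product of copies of `ℤ`, which is discrete. -/
lemma IsLocal.continuous {f : HeightFunction → ℝ} (hf : IsLocal f) : Continuous f := by
  obtain ⟨A, hA⟩ := hf
  let r : HeightFunction → (A → ℤ) := fun s x => s.1 x
  have hr : Continuous r := by
    refine continuous_pi fun x => (continuous_apply (x : ℤ)).comp continuous_subtype_val
  have hfac : Function.FactorsThrough f r := fun s s' h =>
    hA s s' fun x hx => congrFun h ⟨x, hx⟩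
  rw [← hfac.extend_comp (fun _ => (0 : ℝ))]
  exact continuous_of_discreteTopology.comp hr

lemma IsLocal.measurable {f : HeightFunction → ℝ} (hf : IsLocal f) : Measurable f :=
  hf.continuous.measurable

lemma measurable_comp_countable {Ω T : Type*} [MeasurableSpace Ω] [MeasurableSpace T]
    {X : T → Ω → ℝ} (hm : ∀ t, Measurable (X t)) (c : ℕ → T) {k : T → ℕ} (hk : Measurable k) :
    Measurable fun z : T × Ω => X (c (k z.1)) z.2 := by
  have h1 : Measurable fun y : ℕ × Ω => X (c y.1) y.2 :=
    measurable_from_prod_countable_right fun j => hm (c j)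
  exact h1.comp ((hk.comp measurable_fst).prodMk measurable_snd)

/-- Times are rounded up to the grid of mesh `1 / (n + 1)`: paths are only right-continuous, so the
approximation must come from the right. The countable index makes the discretised process jointly
measurable. -/
lemma exists_measurable_approx_from_right : ∃ (c : ℕ → ℕ → ℝ≥0) (k : ℕ → ℝ≥0 → ℕ),
    (∀ n, Measurable (k n)) ∧ (∀ n t, t ≤ c n (k n t)) ∧
      ∀ t, Tendsto (fun n => c n (k n t)) atTop (𝓝 t) := by
  have hpos : ∀ n : ℕ, (0 : ℝ≥0) < n + 1 := fun n => by positivity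
  have hlow : ∀ (n : ℕ) (t : ℝ≥0), t ≤ ((⌊((n : ℝ≥0) + 1) * t⌋₊ : ℝ≥0) + 1) / (n + 1) :=
    fun n t => by
      rw [le_div_iff₀ (hpos n), mul_comm]
      exact (Nat.lt_floor_add_one _).le
  refine ⟨fun n j => ((j : ℝ≥0) + 1) / (n + 1), fun n t => ⌊((n : ℝ≥0) + 1) * t⌋₊,
    fun n => Nat.measurable_floor.comp (measurable_const.mul measurable_id), hlow, fun t => ?_⟩
  have hup : ∀ n : ℕ, ((⌊((n : ℝ≥0) + 1) * t⌋₊ : ℝ≥0) + 1) / (n + 1) ≤ t + 1 / (n + 1) :=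
    fun n => by
      rw [div_le_iff₀ (hpos n), add_mul t, one_div, inv_mul_cancel₀ (hpos n).ne', mul_comm t]
      gcongr
      exact Nat.floor_le zero_le
  refine tendsto_of_tendsto_of_tendsto_of_le_of_le tendsto_const_nhds ?_ (fun n => hlow n t) hup
  have h0 : Tendsto (fun n : ℕ => 1 / ((n : ℝ≥0) + 1)) atTop (𝓝 0) :=
    NNReal.tendsto_coe.1 (by simpa using tendsto_one_div_add_atTop_nhds_zero_nat (𝕜 := ℝ))
  simpa using tendsto_const_nhds (x := t).add h0

/-- A right-continuous process is jointly measurable. -/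
lemma measurable_uncurry_of_rightContinuous {Ω : Type*} [MeasurableSpace Ω] {X : ℝ≥0 → Ω → ℝ}
    (hm : ∀ t, Measurable (X t))
    (hc : ∀ ω t, ContinuousWithinAt (fun u => X u ω) (Set.Ici t) t) :
    Measurable (Function.uncurry X) := by
  obtain ⟨c, k, hk, hck, hlim⟩ := exists_measurable_approx_from_right
  refine measurable_of_tendsto_metrizable
    (f := fun n z => X (c n (k n z.1)) z.2) (fun n => measurable_comp_countable hm _ (hk n))
    (tendsto_pi_nhds.2 fun z => ?_)
  exact (hc z.2 z.1).tendsto.comp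
    (tendsto_nhdsWithin_iff.2 ⟨hlim z.1, Eventually.of_forall fun n => hck n z.1⟩)

/-! ### Integral equations on the half-line -/

lemma continuous_of_eq_integral {g ψ : ℝ → ℝ}
    (hψ : ∀ a b, IntervalIntegrable ψ volume a b)
    (h : ∀ t, 0 ≤ t → g t = g 0 + ∫ u in (0 : ℝ)..t, ψ u) (h0 : ∀ t ≤ 0, g t = g 0) :
    Continuous g := by
  have : g = fun t => g 0 + ∫ u in (0 : ℝ)..(max t 0), ψ u := by
    ext t
    rcases le_total t 0 with ht | ht
    · simp [max_eq_right ht, h0 t ht]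
    · rw [max_eq_left ht, h t ht]
  rw [this]
  exact continuous_const.add
    ((intervalIntegral.continuous_primitive hψ 0).comp (continuous_id.max continuous_const))

/-- Grönwall's inequality in integral form. -/
lemma le_mul_exp_of_le_integral {g : ℝ → ℝ} (hg : Continuous g) {a C : ℝ} (hC : 0 ≤ C)
    (h : ∀ t, 0 ≤ t → g t ≤ a + C * ∫ u in (0 : ℝ)..t, g u) {t : ℝ} (ht : 0 ≤ t) :
    g t ≤ a * Real.exp (C * t) := by
  -- The derivative of `H` is `C e^(-Ct) (g t - (a + C ∫ g))`, which the hypothesis makes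
  -- nonpositive for `t ≥ 0`.
  let H : ℝ → ℝ := fun t => (a + C * ∫ u in (0 : ℝ)..t, g u) * Real.exp (-(C * t))
  have hd : ∀ t, HasDerivAt H (C * g t * Real.exp (-(C * t))
      + (a + C * ∫ u in (0 : ℝ)..t, g u) * (Real.exp (-(C * t)) * -C)) t := fun t => by
    have h1 : HasDerivAt (fun t => ∫ u in (0 : ℝ)..t, g u) (g t) t :=
      (hg.integral_hasStrictDerivAt 0 t).hasDerivAt
    have h2 : HasDerivAt (fun t : ℝ => -(C * t)) (-C) t := by
      simpa using (hasDerivAt_const_mul (x := t) C).fun_neg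
    exact ((h1.const_mul C).const_add a).mul h2.exp
  have hanti : AntitoneOn H (Set.Ici 0) := by
    refine antitoneOn_of_deriv_nonpos (convex_Ici 0)
      (fun t _ => (hd t).continuousAt.continuousWithinAt)
      (fun t _ => (hd t).differentiableAt.differentiableWithinAt) fun t ht => ?_
    rw [interior_Ici] at ht
    rw [(hd t).deriv]
    have := mul_le_mul_of_nonneg_left (h t (le_of_lt ht)) hC
    nlinarith [Real.exp_pos (-(C * t))]
  have h1 : H t ≤ a := by simpa [H] using hanti Set.self_mem_Ici ht ht
  refine (h t ht).trans ?_
  rw [← div_le_iff₀ (Real.exp_pos _), div_eq_mul_inv, ← Real.exp_neg]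
  exact h1

end DynASEP

namespace DynASEP

/-! ### Dynkin's formula for local functions -/

lemma exists_abs_dynamicGenerator_le {q α : ℝ} (hq : 0 < q) (hq1 : q < 1) (hα : 0 < α)
    {f : HeightFunction → ℝ} (hf : IsLocal f) (hb : ∃ C : ℝ, ∀ s, |f s| ≤ C) :
    ∃ C : ℝ, ∀ s, |dynamicGenerator q α f s| ≤ C := by
  obtain ⟨A, hA⟩ := hf
  obtain ⟨C, hC⟩ := hb
  refine ⟨∑ _x ∈ A, ((C + C) + (C + C)), fun s => ?_⟩
  rw [DependsOnSites.dynamicGenerator_eq hA]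
  refine (Finset.abs_sum_le_sum_abs _ _).trans (Finset.sum_le_sum fun x _ => ?_)
  refine (abs_siteGenerator_le hq hq1 hα f x s).trans ?_
  exact add_le_add ((abs_sub _ _).trans (add_le_add (hC _) (hC _)))
    ((abs_sub _ _).trans (add_le_add (hC _) (hC _)))

section DynamicASEP

variable {Ω : Type*} [mΩ : MeasurableSpace Ω] {q α : ℝ} {𝓕 : Filtration ℝ≥0 mΩ} {P : Measure Ω}
  {s : ℝ≥0 → Ω → HeightFunction}

lemma IsDynamicASEP.measurable (hs : IsDynamicASEP q α 𝓕 P s) (t : ℝ≥0) : Measurable (s t) :=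
  (hs.adapted t).mono (𝓕.le t) le_rfl

lemma IsDynamicASEP.measurable_local (hs : IsDynamicASEP q α 𝓕 P s) {f : HeightFunction → ℝ}
    (hf : IsLocal f) (t : ℝ≥0) : Measurable fun ω => f (s t ω) :=
  hf.measurable.comp (hs.measurable t)

lemma IsDynamicASEP.measurable_uncurry (hs : IsDynamicASEP q α 𝓕 P s) {f : HeightFunction → ℝ}
    (hf : IsLocal f) : Measurable fun z : ℝ × Ω => f (s z.1.toNNReal z.2) := by
  have h1 : Measurable (Function.uncurry fun (t : ℝ≥0) (ω : Ω) => f (s t ω)) :=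
    measurable_uncurry_of_rightContinuous (hs.measurable_local hf) fun ω t =>
      hf.continuous.continuousAt.comp_continuousWithinAt (hs.right_continuous ω t)
  have h2 : Measurable fun z : ℝ × Ω => (z.1.toNNReal, z.2) :=
    (measurable_real_toNNReal.comp measurable_fst).prodMk measurable_snd
  exact h1.comp h2

lemma IsDynamicASEP.stronglyMeasurable_expectation [SFinite P] (hs : IsDynamicASEP q α 𝓕 P s)
    {f : HeightFunction → ℝ} (hf : IsLocal f) :
    StronglyMeasurable fun u : ℝ => ∫ ω, f (s u.toNNReal ω) ∂P :=
  (hs.measurable_uncurry hf).stronglyMeasurable.integral_prod_right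

lemma IsDynamicASEP.integrable_of_bounded [IsFiniteMeasure P] (hs : IsDynamicASEP q α 𝓕 P s)
    {f : HeightFunction → ℝ} (hf : IsLocal f) (hb : ∃ C : ℝ, ∀ σ, |f σ| ≤ C) (t : ℝ≥0) :
    Integrable (fun ω => f (s t ω)) P := by
  obtain ⟨C, hC⟩ := hb
  exact .of_bound (hs.measurable_local hf t).aestronglyMeasurable C (.of_forall fun ω => hC _)

/-- Dynkin's formula for bounded local functions. -/
lemma IsDynamicASEP.integral_eq_of_bounded [IsFiniteMeasure P] (hs : IsDynamicASEP q α 𝓕 P s)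
    (hq : 0 < q) (hq1 : q < 1) (hα : 0 < α) {f : HeightFunction → ℝ} (hf : IsLocal f)
    (hb : ∃ C : ℝ, ∀ σ, |f σ| ≤ C) {t : ℝ} (ht : 0 ≤ t) :
    ∫ ω, f (s t.toNNReal ω) ∂P = ∫ ω, f (s 0 ω) ∂P +
      ∫ u in (0 : ℝ)..t, ∫ ω, dynamicGenerator q α f (s u.toNNReal ω) ∂P := by
  have hM := hs.martingale f hf hb
  have hLf := isLocal_dynamicGenerator hf q α
  obtain ⟨C, hC⟩ := exists_abs_dynamicGenerator_le hq hq1 hα hf hb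
  have h1 := hM.setIntegral_eq (zero_le (a := t.toNNReal)) (MeasurableSet.univ)
  simp only [setIntegral_univ, NNReal.coe_zero, intervalIntegral.integral_same, sub_zero,
    Real.coe_toNNReal t ht] at h1
  have hint := hs.integrable_of_bounded hf hb t.toNNReal
  -- The time integral is the difference of `f (s t)` and the martingale, both integrable.
  have hint' : Integrable (fun ω => ∫ u in (0 : ℝ)..t, dynamicGenerator q α f (s u.toNNReal ω))
      P := by
    have := hint.sub (hM.integrable t.toNNReal)
    refine this.congr (.of_forall fun ω => ?_)
    simp [Real.coe_toNNReal t ht]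
  rw [integral_sub hint hint'] at h1
  have hswap : ∫ ω, (∫ u in (0 : ℝ)..t, dynamicGenerator q α f (s u.toNNReal ω)) ∂P
      = ∫ u in (0 : ℝ)..t, ∫ ω, dynamicGenerator q α f (s u.toNNReal ω) ∂P := by
    simp only [intervalIntegral.integral_of_le ht]
    refine (integral_integral_swap ?_).symm
    exact .of_bound (hs.measurable_uncurry hLf).aestronglyMeasurable C (.of_forall fun z => hC _)
  rw [hswap] at h1
  linarith

/-! ### Exponential moments -/

lemma isLocal_heightWeight (r : ℝ) (n : ℕ) : IsLocal (heightWeight r n) :=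
  ⟨_, dependsOnSites_heightWeight r n⟩

/-- Multiplicative growth bounds with a constant `K ≥ 1` survive truncation with the same constant.
-/
lemma clip_mul_le {M K z : ℝ} (hM : 0 ≤ M) (hK : 1 ≤ K) (hz : 0 ≤ z) :
    clip M (K * z) ≤ K * clip M z := by
  rw [clip, clip, max_eq_left, max_eq_left, mul_min_of_nonneg _ _ (zero_le_one.trans hK)]
  · exact min_le_min le_rfl (le_mul_of_one_le_left hM hK)
  · exact (neg_nonpos.2 hM).trans (le_min hz hM)
  · exact (neg_nonpos.2 hM).trans (le_min (mul_nonneg (zero_le_one.trans hK) hz) hM)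

lemma clip_mono (M : ℝ) : Monotone (clip M) := fun _ _ h =>
  max_le_max (min_le_min h le_rfl) le_rfl

lemma clip_nonneg {M z : ℝ} (hM : 0 ≤ M) (hz : 0 ≤ z) : 0 ≤ clip M z :=
  le_max_of_le_left (le_min hz hM)

/-- Only the two jumps at the origin matter, each at rate at most one and enlarging the weight by at
most `(r ^ 2) ^ n`. The constant does not depend on `M`, so the Grönwall bound is uniform in the
truncation. -/
lemma abs_dynamicGenerator_clip_heightWeight_le (hq : 0 < q) (hq1 : q < 1) (hα : 0 < α) {r : ℝ}
    (hr : 1 ≤ r) (n : ℕ) {M : ℝ} (hM : 0 ≤ M) (σ : HeightFunction) :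
    |dynamicGenerator q α (fun s' => clip M (heightWeight r n s')) σ|
      ≤ 2 * (r ^ 2) ^ n * clip M (heightWeight r n σ) := by
  have hV : ∀ s, 0 ≤ heightWeight r n s := fun s => zero_le_one.trans (one_le_heightWeight hr n s)
  have hA : DependsOnSites (fun s' => clip M (heightWeight r n s')) {0} := fun s s' h => by
    simp only [dependsOnSites_heightWeight r n s s' h]
  have hK : 1 ≤ (r ^ 2) ^ n := one_le_pow₀ (one_le_pow₀ hr)
  have hjump : ∀ d : ℤ, |d| = 2 → |clip M (heightWeight r n (σ.jump 0 d))
      - clip M (heightWeight r n σ)| ≤ (r ^ 2) ^ n * clip M (heightWeight r n σ) := by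
    intro d hd
    have h0 := clip_nonneg hM (hV (σ.jump 0 d))
    have h1 := clip_nonneg hM (hV σ)
    have h2 := (clip_mono M (heightWeight_jump_le hr n σ 0 hd)).trans (clip_mul_le hM hK (hV σ))
    rw [abs_le]
    constructor <;> nlinarith
  rw [hA.dynamicGenerator_eq, Finset.sum_singleton]
  refine (abs_siteGenerator_le hq hq1 hα _ _ _).trans ?_
  linarith [hjump (-2) (by norm_num), hjump 2 (by norm_num)]

/-- Expectations with a continuous bound are locally integrable in time. -/
lemma IsDynamicASEP.intervalIntegrable_expectation [SFinite P] (hs : IsDynamicASEP q α 𝓕 P s)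
    {f : HeightFunction → ℝ} (hf : IsLocal f) {G : ℝ → ℝ} (hG : Continuous G)
    (h : ∀ u : ℝ, |∫ ω, f (s u.toNNReal ω) ∂P| ≤ G u) (a b : ℝ) :
    IntervalIntegrable (fun u : ℝ => ∫ ω, f (s u.toNNReal ω) ∂P) volume a b :=
  (hG.intervalIntegrable a b).mono_fun (hs.stronglyMeasurable_expectation hf).aestronglyMeasurable
    (.of_forall fun u => (h u).trans (le_abs_self _))

lemma IsDynamicASEP.integrable_of_abs_le (hs : IsDynamicASEP q α 𝓕 P s)
    {f : HeightFunction → ℝ} (hf : IsLocal f) {r C : ℝ} {n : ℕ}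
    (hC : ∀ σ, |f σ| ≤ C * heightWeight r n σ) {t : ℝ≥0}
    (ht : Integrable (fun ω => heightWeight r n (s t ω)) P) :
    Integrable (fun ω => f (s t ω)) P :=
  (ht.const_mul C).mono' (hs.measurable_local hf t).aestronglyMeasurable (.of_forall fun _ => hC _)

variable [IsProbabilityMeasure P]

lemma abs_integral_le_of_abs_le {f : Ω → ℝ} {C : ℝ} (h : ∀ ω, |f ω| ≤ C) :
    |∫ ω, f ω ∂P| ≤ C := by
  simpa using norm_integral_le_of_norm_le_const (μ := P) (f := f) (.of_forall h)

lemma IsDynamicASEP.integral_clip_heightWeight_le (hs : IsDynamicASEP q α 𝓕 P s)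
    (hq : 0 < q) (hq1 : q < 1) (hα : 0 < α) {r : ℝ} (hr : 1 ≤ r) (n : ℕ) {M : ℝ} (hM : 0 ≤ M)
    (t : ℝ≥0) : ∫ ω, clip M (heightWeight r n (s t ω)) ∂P ≤
      (∫ ω, clip M (heightWeight r n (s 0 ω)) ∂P) * Real.exp (2 * (r ^ 2) ^ n * t) := by
  have hf : IsLocal fun s' => clip M (heightWeight r n s') := (isLocal_heightWeight r n).clip M
  have hb : ∃ C : ℝ, ∀ σ, |clip M (heightWeight r n σ)| ≤ C := ⟨M, fun σ => abs_clip_le hM _⟩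
  have hLf := isLocal_dynamicGenerator hf q α
  obtain ⟨C, hC⟩ := exists_abs_dynamicGenerator_le hq hq1 hα hf hb
  let g : ℝ → ℝ := fun u => ∫ ω, clip M (heightWeight r n (s u.toNNReal ω)) ∂P
  have hψ := hs.intervalIntegrable_expectation hLf (G := fun _ => C) continuous_const
    fun u => abs_integral_le_of_abs_le fun ω => hC _
  have hdyn : ∀ t, 0 ≤ t → g t = g 0 + ∫ u in (0 : ℝ)..t, ∫ ω, dynamicGenerator q α
      (fun s' => clip M (heightWeight r n s')) (s u.toNNReal ω) ∂P := fun t ht => by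
    simpa [g] using hs.integral_eq_of_bounded hq hq1 hα hf hb ht
  have hg : Continuous g := continuous_of_eq_integral hψ hdyn fun t ht => by
    simp [g, Real.toNNReal_of_nonpos ht]
  have := le_mul_exp_of_le_integral hg (a := g 0) (C := 2 * (r ^ 2) ^ n) (by positivity)
    (fun t ht => ?_) t.2
  · simpa [g] using this
  rw [hdyn t ht, ← intervalIntegral.integral_const_mul]
  refine add_le_add le_rfl (intervalIntegral.integral_mono_on ht (hψ 0 t)
    ((hg.intervalIntegrable 0 t).const_mul _) fun u _ => ?_)
  rw [← integral_const_mul]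
  exact integral_mono (hs.integrable_of_bounded hLf ⟨C, hC⟩ _)
    ((hs.integrable_of_bounded hf hb _).const_mul _)
    fun ω => (le_abs_self _).trans
      (abs_dynamicGenerator_clip_heightWeight_le hq hq1 hα hr n hM _)

/-- Exponential moments of the height at the origin propagate in time. -/
lemma IsDynamicASEP.integrable_heightWeight (hs : IsDynamicASEP q α 𝓕 P s)
    (hq : 0 < q) (hq1 : q < 1) (hα : 0 < α) {r : ℝ} (hr : 1 ≤ r) (n : ℕ)
    (h0 : Integrable (fun ω => heightWeight r n (s 0 ω)) P) (t : ℝ≥0) :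
    Integrable (fun ω => heightWeight r n (s t ω)) P ∧
      ∫ ω, heightWeight r n (s t ω) ∂P ≤
        (∫ ω, heightWeight r n (s 0 ω) ∂P) * Real.exp (2 * (r ^ 2) ^ n * t) := by
  have hV : ∀ s, 0 ≤ heightWeight r n s := fun s => zero_le_one.trans (one_le_heightWeight hr n s)
  have hloc := isLocal_heightWeight r n
  set K := (∫ ω, heightWeight r n (s 0 ω) ∂P) * Real.exp (2 * (r ^ 2) ^ n * t) with hK
  have hint : ∀ (N : ℕ) u, Integrable (fun ω => clip N (heightWeight r n (s u ω))) P :=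
    fun N u => hs.integrable_of_bounded (hloc.clip N)
      ⟨N, fun σ => abs_clip_le (Nat.cast_nonneg N) _⟩ u
  have hbound : ∀ N : ℕ, ∫ ω, clip N (heightWeight r n (s t ω)) ∂P ≤ K := fun N => by
    refine (hs.integral_clip_heightWeight_le hq hq1 hα hr n (Nat.cast_nonneg N) t).trans ?_
    refine mul_le_mul_of_nonneg_right (integral_mono (hint N 0) h0 fun ω => ?_)
      (Real.exp_pos _).le
    refine (le_abs_self _).trans ((abs_clip_le_abs (Nat.cast_nonneg N) _).trans_eq ?_)
    exact abs_of_nonneg (hV _)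
  have hmeas := hs.measurable_local hloc t
  -- Fatou's lemma removes the truncation from the uniform bound.
  have hfatou : ∫⁻ ω, ENNReal.ofReal (heightWeight r n (s t ω)) ∂P ≤ ENNReal.ofReal K := by
    have hlim : ∀ ω, liminf (fun N : ℕ => ENNReal.ofReal (clip N (heightWeight r n (s t ω))))
        atTop = ENNReal.ofReal (heightWeight r n (s t ω)) := fun ω =>
      (ENNReal.tendsto_ofReal (tendsto_clip _)).liminf_eq
    simp_rw [← hlim]
    refine (lintegral_liminf_le (u := atTop) fun (N : ℕ) =>
      (hs.measurable_local (hloc.clip N) t).ennreal_ofReal).trans ?_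
    refine liminf_le_of_le (f := atTop) (by isBoundedDefault) fun b hb => ?_
    obtain ⟨N, hN⟩ := hb.exists
    refine hN.trans ?_
    rw [← ofReal_integral_eq_lintegral_ofReal (hint N t)
      (.of_forall fun ω => clip_nonneg (Nat.cast_nonneg N) (hV _))]
    exact ENNReal.ofReal_le_ofReal (hbound N)
  have hI : Integrable (fun ω => heightWeight r n (s t ω)) P :=
    ⟨hmeas.aestronglyMeasurable, (hasFiniteIntegral_iff_ofReal (.of_forall fun ω => hV _)).2
      (hfatou.trans_lt ENNReal.ofReal_lt_top)⟩
  refine ⟨hI, ?_⟩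
  rw [← ofReal_integral_eq_lintegral_ofReal hI (.of_forall fun ω => hV _)] at hfatou
  refine (ENNReal.ofReal_le_ofReal_iff ?_).1 hfatou
  exact mul_nonneg (integral_nonneg fun ω => hV _) (Real.exp_pos _).le

/-! ### Dynkin's formula for local functions of exponential growth -/

/-- Clipping is 1-Lipschitz, so the increments are bounded uniformly in `N`; this supplies the
dominating function for the passage to the limit. -/
lemma exists_abs_dynamicGenerator_clip_le {f : HeightFunction → ℝ} (hf : IsLocal f) {r : ℝ} (hr : 1 ≤ r)
    {n : ℕ} (hq : 0 < q) (hq1 : q < 1) (hα : 0 < α)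
    (hC : ∃ C : ℝ, ∀ σ, |f σ| ≤ C * heightWeight r n σ) :
    ∃ D : ℝ, ∀ (N : ℕ) (σ : HeightFunction),
      |dynamicGenerator q α (fun s' => clip N (f s')) σ| ≤ D * heightWeight r n σ := by
  obtain ⟨A, hA⟩ := hf
  obtain ⟨C, hC⟩ := hC
  refine ⟨∑ _x ∈ A, 2 * (|C| * (r ^ 2) ^ n + |C|), fun N σ => ?_⟩
  have hA' : DependsOnSites (fun s' => clip N (f s')) A := fun s s' h => by simp only [hA s s' h]
  have hV : ∀ s, 0 ≤ heightWeight r n s := fun s => zero_le_one.trans (one_le_heightWeight hr n s)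
  have hC' : ∀ σ, |f σ| ≤ |C| * heightWeight r n σ := fun σ =>
    (hC σ).trans (mul_le_mul_of_nonneg_right (le_abs_self C) (hV σ))
  have hjump : ∀ (x d : ℤ), |d| = 2 → |clip N (f (σ.jump x d)) - clip N (f σ)| ≤
      (|C| * (r ^ 2) ^ n + |C|) * heightWeight r n σ := by
    intro x d hd
    refine (abs_clip_sub_clip_le _ _ _).trans ((abs_sub _ _).trans ?_)
    have h1 := mul_le_mul_of_nonneg_left (heightWeight_jump_le hr n σ x hd) (abs_nonneg C)
    linarith [hC' (σ.jump x d), hC' σ]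
  rw [hA'.dynamicGenerator_eq, Finset.sum_mul]
  refine (Finset.abs_sum_le_sum_abs _ _).trans (Finset.sum_le_sum fun x _ => ?_)
  refine (abs_siteGenerator_le hq hq1 hα _ x σ).trans ?_
  linarith [hjump x (-2) (by norm_num), hjump x 2 (by norm_num)]

/-- Dynkin's formula for local functions of exponential growth, with the continuity of the
expectation. -/
lemma IsDynamicASEP.integral_eq (hs : IsDynamicASEP q α 𝓕 P s)
    (hq : 0 < q) (hq1 : q < 1) (hα : 0 < α) {f : HeightFunction → ℝ} (hf : IsLocal f)
    {r : ℝ} (hr : 1 ≤ r) {n : ℕ} (hC : ∃ C : ℝ, ∀ σ, |f σ| ≤ C * heightWeight r n σ)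
    (h0 : Integrable (fun ω => heightWeight r n (s 0 ω)) P) :
    Continuous (fun u : ℝ => ∫ ω, f (s u.toNNReal ω) ∂P) ∧
      ∀ t : ℝ, 0 ≤ t → ∫ ω, f (s t.toNNReal ω) ∂P = ∫ ω, f (s 0 ω) ∂P +
        ∫ u in (0 : ℝ)..t, ∫ ω, dynamicGenerator q α f (s u.toNNReal ω) ∂P := by
  have hV := fun u => hs.integrable_heightWeight hq hq1 hα hr n h0 u
  obtain ⟨D, hD⟩ := exists_abs_dynamicGenerator_clip_le hf hr hq hq1 hα hC
  obtain ⟨C, hC⟩ := hC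
  have hLf := isLocal_dynamicGenerator hf q α
  have hLc := fun N : ℕ => isLocal_dynamicGenerator (hf.clip N) q α
  have hV0 : ∀ s, 0 ≤ heightWeight r n s := fun s => zero_le_one.trans (one_le_heightWeight hr n s)
  have hD' : ∀ (N : ℕ) (σ : HeightFunction),
      |dynamicGenerator q α (fun s' => clip N (f s')) σ| ≤ |D| * heightWeight r n σ := fun N σ =>
    (hD N σ).trans (mul_le_mul_of_nonneg_right (le_abs_self D) (hV0 σ))
  have hLD : ∀ σ, |dynamicGenerator q α f σ| ≤ |D| * heightWeight r n σ := fun σ =>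
    le_of_tendsto (tendsto_dynamicGenerator_clip hf q α σ).abs (.of_forall fun N => hD' N σ)
  -- A continuous bound, uniform in the truncation; `max u 0` matches `u.toNNReal` at negative
  -- times.
  let G : ℝ → ℝ := fun u => |D| * ((∫ ω, heightWeight r n (s 0 ω) ∂P) *
    Real.exp (2 * (r ^ 2) ^ n * max u 0))
  have hG : Continuous G := by fun_prop
  have hEG : ∀ h : HeightFunction → ℝ, (∀ σ, |h σ| ≤ |D| * heightWeight r n σ) →
      ∀ u : ℝ, |∫ ω, h (s u.toNNReal ω) ∂P| ≤ G u := fun h hh u => by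
    refine (norm_integral_le_of_norm_le (f := fun ω => h (s u.toNNReal ω)) ((hV u.toNNReal).1.const_mul |D|)
      (.of_forall fun ω => hh _)).trans ?_
    rw [integral_const_mul]
    exact mul_le_mul_of_nonneg_left (hV u.toNNReal).2 (abs_nonneg D)
  have hclip : ∀ u, Tendsto (fun N : ℕ => ∫ ω, clip N (f (s u ω)) ∂P) atTop
      (𝓝 (∫ ω, f (s u ω) ∂P)) := fun u =>
    tendsto_integral_of_dominated_convergence _
      (fun N => (hs.measurable_local (hf.clip N) u).aestronglyMeasurable)
      ((hV u).1.const_mul C)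
      (fun N => .of_forall fun ω => (abs_clip_le_abs (Nat.cast_nonneg N) _).trans (hC _))
      (.of_forall fun ω => tendsto_clip _)
  have hLclip : ∀ u, Tendsto (fun N : ℕ => ∫ ω, dynamicGenerator q α
      (fun s' => clip N (f s')) (s u ω) ∂P) atTop
      (𝓝 (∫ ω, dynamicGenerator q α f (s u ω) ∂P)) := fun u =>
    tendsto_integral_of_dominated_convergence _
      (fun N => (hs.measurable_local (hLc N) u).aestronglyMeasurable)
      ((hV u).1.const_mul |D|) (fun N => .of_forall fun ω => hD' N _)
      (.of_forall fun ω => tendsto_dynamicGenerator_clip hf q α _)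
  have hdyn : ∀ t : ℝ, 0 ≤ t → ∫ ω, f (s t.toNNReal ω) ∂P = ∫ ω, f (s 0 ω) ∂P +
      ∫ u in (0 : ℝ)..t, ∫ ω, dynamicGenerator q α f (s u.toNNReal ω) ∂P := fun t ht => by
    refine tendsto_nhds_unique (hclip t.toNNReal) ?_
    simp_rw [fun N : ℕ => hs.integral_eq_of_bounded hq hq1 hα (hf.clip N)
      ⟨N, fun σ => abs_clip_le (Nat.cast_nonneg N) _⟩ ht]
    refine (hclip 0).add ?_
    refine intervalIntegral.tendsto_integral_filter_of_dominated_convergence G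
      (.of_forall fun N => (hs.stronglyMeasurable_expectation (hLc N)).aestronglyMeasurable)
      (.of_forall fun N => .of_forall fun u _ => hEG _ (hD' N) u) (hG.intervalIntegrable 0 t)
      (.of_forall fun u _ => hLclip u.toNNReal)
  refine ⟨continuous_of_eq_integral (hs.intervalIntegrable_expectation hLf hG (hEG _ hLD))
    (fun t ht => by simpa using hdyn t ht) fun t ht => by simp [Real.toNNReal_of_nonpos ht], hdyn⟩

end DynamicASEP

end DynASEP

namespace DynASEP

/-! ### ### Expectations under the particle generator and the initial moment -/

lemma integral_asepGenerator {Ω : Type*} [MeasurableSpace Ω] {P : Measure Ω} {n : ℕ} (l r : ℝ)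
    (F : Config n → Ω → ℝ) (hF : ∀ x, Integrable (F x) P) (x : Config n) :
    ∫ ω, asepGenerator n l r (fun x' => F x' ω) x ∂P
      = asepGenerator n l r (fun x' => ∫ ω, F x' ω ∂P) x := by
  have h : ∀ (a : ℝ) (y : Config n), Integrable (fun ω => a * (F y ω - F x ω)) P :=
    fun a y => ((hF y).sub (hF x)).const_mul a
  simp only [asepGenerator]
  rw [integral_finsetSum _ fun i _ =>
    (h l (x.move i (-1))).fun_add (h r (x.move i 1))]
  refine Finset.sum_congr rfl fun i _ => ?_
  rw [integral_add (h _ _) (h _ _), integral_const_mul, integral_const_mul,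
    integral_sub (hF _) (hF _), integral_sub (hF _) (hF _)]

lemma continuous_asepGenerator {n : ℕ} (l r : ℝ) {φ : Config n → ℝ → ℝ}
    (hφ : ∀ x, Continuous (φ x)) (x : Config n) :
    Continuous fun u => asepGenerator n l r (fun x' => φ x' u) x := by
  simp only [asepGenerator]
  fun_prop

/-- Any configuration can be used to test for exponential moments at time zero. -/
lemma integrable_heightWeight_of_dualityZ {Ω : Type*} [MeasurableSpace Ω] {P : Measure Ω}
    [IsFiniteMeasure P] {r : ℝ} (hr : 1 ≤ r) {α : ℝ} (hα : 0 < α) {n : ℕ} (x : Config n)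
    {σ : Ω → HeightFunction} (hσ : Measurable σ)
    (h : Integrable (fun ω => dualityZ n ((r ^ 2)⁻¹) α x (σ ω)) P) :
    Integrable (fun ω => heightWeight r n (σ ω)) P := by
  obtain ⟨C, C', hC⟩ := exists_heightWeight_le hr hα x
  refine ((h.abs.const_mul C).add (integrable_const C')).mono'
    ((isLocal_heightWeight r n).measurable.comp hσ).aestronglyMeasurable (.of_forall fun ω => ?_)
  rw [Real.norm_of_nonneg (zero_le_one.trans (one_le_heightWeight hr n _))]
  exact hC _

end DynASEP

end

theorem theorem2p1 (n : ℕ) (hn : 1 ≤ n) (q α : ℝ) (hq0 : 0 < q) (hq1 : q < 1) (hα : 0 < α) :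
    -- the Markov duality
    (∀ (x : DynASEP.Config n) (s : DynASEP.HeightFunction),
      DynASEP.dynamicGenerator q α (fun s' => DynASEP.dualityZ n q α x s') s
        = DynASEP.asepGenerator n 1 q (fun x' => DynASEP.dualityZ n q α x' s) x) ∧
    -- the evolution equation, for dynamic ASEP started from a fixed initial state
    -- (where integrability at time zero is automatic) or from a random one
    (∀ {Ω : Type*} [mΩ : MeasurableSpace Ω] (𝓕 : Filtration ℝ≥0 mΩ) (P : Measure Ω)
      [IsProbabilityMeasure P] (s : ℝ≥0 → Ω → DynASEP.HeightFunction),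
      DynASEP.IsDynamicASEP q α 𝓕 P s →
      ((∃ s₀ : DynASEP.HeightFunction, ∀ᵐ ω ∂P, s 0 ω = s₀) ∨
        (∀ x : DynASEP.Config n, Integrable (fun ω => DynASEP.dualityZ n q α x (s 0 ω)) P)) →
      (∀ (x : DynASEP.Config n) (t : ℝ≥0),
        Integrable (fun ω => DynASEP.dualityZ n q α x (s t ω)) P) ∧
      ∀ (x : DynASEP.Config n) (t : ℝ), 0 ≤ t →
        HasDerivWithinAt
          (fun u : ℝ => ∫ ω, DynASEP.dualityZ n q α x (s u.toNNReal ω) ∂P)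
          (DynASEP.asepGenerator n 1 q
            (fun x' => ∫ ω, DynASEP.dualityZ n q α x' (s t.toNNReal ω) ∂P) x)
          (Set.Ici 0) t) := by
  obtain ⟨r, hr, rfl⟩ : ∃ r : ℝ, 1 ≤ r ∧ q = (r ^ 2)⁻¹ := by
    refine ⟨√q⁻¹, Real.one_le_sqrt.2 ((one_le_inv₀ hq0).2 hq1.le), ?_⟩
    rw [Real.sq_sqrt (inv_pos.2 hq0).le, inv_inv]
  refine ⟨fun x s => DynASEP.dynamicGenerator_dualityZ hq0 hα x s, ?_⟩
  intro Ω mΩ 𝓕 P _ s hs hinit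
  have h0 : Integrable (fun ω => DynASEP.heightWeight r n (s 0 ω)) P := by
    rcases hinit with ⟨s₀, hs₀⟩ | hZ
    · refine (integrable_const (DynASEP.heightWeight r n s₀)).congr ?_
      filter_upwards [hs₀] with ω hω
      rw [hω]
    -- The packed configuration `0, -1, …, -(n - 1)`; any configuration would do.
    · let x₀ : DynASEP.Config n :=
        ⟨fun i => -(i : ℤ), fun i j hij => neg_lt_neg (by exact_mod_cast hij)⟩
      exact DynASEP.integrable_heightWeight_of_dualityZ hr hα x₀ (hs.measurable 0) (hZ x₀)
  have hint : ∀ (x : DynASEP.Config n) (t : ℝ≥0),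
      Integrable (fun ω => DynASEP.dualityZ n (r ^ 2)⁻¹ α x (s t ω)) P := fun x t => by
    obtain ⟨C, hC⟩ := DynASEP.exists_abs_dualityZ_le hr hα x
    exact hs.integrable_of_abs_le (DynASEP.isLocal_dualityZ _ α x) hC
      (hs.integrable_heightWeight hq0 hq1 hα hr n h0 t).1
  refine ⟨hint, fun x t ht => ?_⟩
  have hdyn := fun y => hs.integral_eq hq0 hq1 hα (DynASEP.isLocal_dualityZ (r ^ 2)⁻¹ α y) hr
    (DynASEP.exists_abs_dualityZ_le hr hα y) h0
  have hcont := DynASEP.continuous_asepGenerator 1 (r ^ 2)⁻¹ (fun y => (hdyn y).1) x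
  -- The fundamental theorem of calculus, applied to the continuous integrand that duality provides.
  have hderiv := ((hcont.integral_hasStrictDerivAt 0 t).hasDerivAt.const_add
    (∫ ω, DynASEP.dualityZ n (r ^ 2)⁻¹ α x (s 0 ω) ∂P)).hasDerivWithinAt (s := Set.Ici 0)
  -- Dynkin's formula holds only for `u ≥ 0`, hence the derivative within `Set.Ici 0`, one-sided at
  -- `0`.
  refine hderiv.congr_of_mem (fun u hu => ?_) ht
  rw [(hdyn x).2 u hu]
  simp_rw [DynASEP.dynamicGenerator_dualityZ hq0 hα x]
  simp_rw [DynASEP.integral_asepGenerator _ _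
    (fun y ω => DynASEP.dualityZ n (r ^ 2)⁻¹ α y (s _ ω)) (fun y => hint y _)]
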